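/- Let $N\ge 1$ and $\alpha\ge 0$, let $[\alpha]$ be the integer part of $\alpha$, and let $\mathcal P_{[\alpha]}$ be the polynomials on $\mathbb R^N$ of degree at most $[\alpha]$. For a locally square-integrable (real- or complex-valued) function $g$ on $\mathbb R^N$ and a cube $Q$ (sides parallel to the axes), let $p_Q(g)\in\mathcal P_{[\alpha]}$ be the unique polynomial such that $(g-p_Q(g))\chi_Q$ has vanishing moments up to order $[\alpha]$. For a family $\mathcal J$ of cubes put \[ \|g\|_{\Lambda_{\alpha,\mathcal J}}=\Big\| \sup_{x\in Q,\,Q\in\mathcal J}\frac1{|Q|^{\alpha/N}}\Big(\frac1{|Q|}\int_Q|g(y)-p_Q(g)(y)|^2\,dy\Big)^{1/2}\Big\|_{L^\infty(dx)}, \] and let $\Lambda_{\alpha,\mathcal J}$ be the set of those $g$ for which this is finite. Write $\Lambda_\alpha$ when $\mathcal J$ consists of all cubes, and $\Lambda_{\alpha,\mathcal D}$ when $\mathcal J=\mathcal D$ is the family of dyadic cubes $\prod_{i=1}^N[(k_i-1)2^n,k_i2^n]$, $n\in\mathbb Z$, $k\in\mathbb Z^N$. Let $Q_0=[-1,1]^N$,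 and let $A\subset L^2(Q_0)$ be the finite-dimensional subspace of the functions with vanishing moments up to order $[\alpha]$ which coincide with a polynomial in $\mathcal P_{[\alpha]}$ on each of the $2^N$ subcubes of $Q_0$ that are products of the intervals $[-1,0]$ and $[0,1]$. Let $p^1,\dots,p^M$ be an orthonormal basis of $A$, extended by $0$ outside $Q_0$, and let \[ \mathcal S_\alpha=\{\,2^{n(N+\alpha)}p^L(2^nx+k): n\in\mathbb Z,\ k\in\mathbb Z^N,\ 1\le L\le M\,\},\qquad A_\alpha(g)=\sup_{p\in\mathcal S_\alpha}|\langle g,p\rangle|, \] where $\langle g,p\rangle=\int g\,\overline{p}$. Theorem. Let $g$ be locally square-integrable. Then $g\in\Lambda_\alpha$ if and only if $g\in\Lambda_{\alpha,\mathcal D}$ and $A_\alpha(g)<\infty$. Moreover there are constants $c,C>0$, depending only on $N$ and $\alpha$, such that \[ c\,\big(\|g\|_{\Lambda_{\alpha,\mathcal D}}+A_\alpha(g)\big)\le\|g\|_{\Lambda_\alpha}\le C\,\big(\|g\|_{\Lambda_{\alpha,\mathcal D}}+A_\alpha(g)\big). \] -/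

import Mathlib

open MeasureTheory
open scoped ENNReal NNReal

namespace DyadicLipschitz

noncomputable section

section Polynomials

variable {𝕜 : Type*} [RCLike 𝕜] {N : ℕ}

/-- The function on `ℝ^N` (scalar field `𝕜 = ℝ` or `ℂ`) given by a polynomial in `N` variables. -/
def polyFun (p : MvPolynomial (Fin N) 𝕜) (x : Fin N → ℝ) : 𝕜 :=
  MvPolynomial.eval (fun i => (x i : 𝕜)) p

/-- All moments of `f` over `Q` of order at most `d` vanish. -/
def VanishingMoments (d : ℕ) (Q : Set (Fin N → ℝ)) (f : (Fin N → ℝ) → 𝕜) : Prop :=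
  ∀ β : Fin N → ℕ, ∑ i, β i ≤ d → ∫ x in Q, f x * ∏ i, (x i : 𝕜) ^ β i = 0

/-- `p` has degree at most `d` and `(g - p) χ_Q` has vanishing moments up to order `d`. -/
def IsMomentPoly (d : ℕ) (Q : Set (Fin N → ℝ)) (g : (Fin N → ℝ) → 𝕜)
    (p : MvPolynomial (Fin N) 𝕜) : Prop :=
  p.totalDegree ≤ d ∧ VanishingMoments d Q (fun x => g x - polyFun p x)

open Classical in
/-- The polynomial `p_Q(g)` of degree at most `d` such that `(g - p_Q(g)) χ_Q` has vanishing
moments up to order `d`. It exists and is unique whenever `Q` is a cube and `g` is integrable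
on `Q`, see `existsUnique_isMomentPoly`. -/
def momentPoly (d : ℕ) (Q : Set (Fin N → ℝ)) (g : (Fin N → ℝ) → 𝕜) : MvPolynomial (Fin N) 𝕜 :=
  if h : ∃ p, IsMomentPoly d Q g p then h.choose else 0

end Polynomials

section Cubes

/-- The closed cube with lower corner `a` and side length `ℓ`. -/
def cube {N : ℕ} (a : Fin N → ℝ) (ℓ : ℝ) : Set (Fin N → ℝ) := Set.Icc a (fun i => a i + ℓ)

/-- The family of all (closed, nondegenerate) cubes with sides parallel to the axes. -/
def allCubes (N : ℕ) : Set (Set (Fin N → ℝ)) :=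
  {Q | ∃ (a : Fin N → ℝ) (ℓ : ℝ), 0 < ℓ ∧ Q = cube a ℓ}

/-- The family `𝒟` of dyadic cubes: products of intervals `[(k_i - 1) 2^n, k_i 2^n]`. -/
def dyadicCubes (N : ℕ) : Set (Set (Fin N → ℝ)) :=
  {Q | ∃ (n : ℤ) (k : Fin N → ℤ),
    Q = Set.Icc (fun i => ((k i : ℝ) - 1) * 2 ^ n) (fun i => (k i : ℝ) * 2 ^ n)}

/-- The cube `Q₀ = [-1, 1]^N`. -/
def unitCube (N : ℕ) : Set (Fin N → ℝ) := Set.Icc (fun _ => -1) (fun _ => 1)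

/-- The `2^N` dyadic subcubes of `Q₀`: products of the intervals `[-1, 0]` and `[0, 1]`. -/
def subcube {N : ℕ} (S : Fin N → Bool) : Set (Fin N → ℝ) :=
  Set.Icc (fun i => if S i then 0 else -1) (fun i => if S i then 1 else 0)

end Cubes

section Lipschitz

variable {𝕜 : Type*} [RCLike 𝕜] {N : ℕ}

/-- `g` is (measurable and) square-integrable on every compact set. -/
def LocallySquareIntegrable (g : (Fin N → ℝ) → 𝕜) : Prop :=
  ∀ K : Set (Fin N → ℝ), IsCompact K → MemLp g 2 (volume.restrict K)

/-- The mean oscillation `|Q|^{-α/N} (|Q|⁻¹ ∫_Q |g - p_Q(g)|²)^{1/2}`, `p_Q(g)` of degree at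
most `[α]`. -/
def oscillation (α : ℝ) (g : (Fin N → ℝ) → 𝕜) (Q : Set (Fin N → ℝ)) : ℝ≥0∞ :=
  (1 / volume Q ^ (α / N)) *
    ((1 / volume Q) * ∫⁻ y in Q, ‖g y - polyFun (momentPoly ⌊α⌋₊ Q g) y‖ₑ ^ 2) ^ (1 / 2 : ℝ)

/-- The maximal function: the supremum of the oscillations over the cubes of the family `J`
that contain `x`. -/
def sharpMaximal (α : ℝ) (J : Set (Set (Fin N → ℝ))) (g : (Fin N → ℝ) → 𝕜)
    (x : Fin N → ℝ) : ℝ≥0∞ :=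
  ⨆ Q ∈ J, ⨆ _ : x ∈ Q, oscillation α g Q

/-- The norm `‖g‖_{Λ_{α,J}}`, as an extended nonnegative real: the essential supremum of the
maximal function. -/
def lipNorm (α : ℝ) (J : Set (Set (Fin N → ℝ))) (g : (Fin N → ℝ) → 𝕜) : ℝ≥0∞ :=
  essSup (sharpMaximal α J g) volume

/-- Membership in the space `Λ_{α,J}`. -/
def MemLip (α : ℝ) (J : Set (Set (Fin N → ℝ))) (g : (Fin N → ℝ) → 𝕜) : Prop :=
  LocallySquareIntegrable g ∧ lipNorm α J g < ∞

end Lipschitz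

section HelperFacts

variable {𝕜 : Type*} [RCLike 𝕜] {N : ℕ}

lemma continuous_polyFun (p : MvPolynomial (Fin N) 𝕜) : Continuous (polyFun p) :=
  (MvPolynomial.continuous_eval p).comp
    (continuous_pi fun i => RCLike.continuous_ofReal.comp (continuous_apply i))

lemma polyFun_add (p q : MvPolynomial (Fin N) 𝕜) (x : Fin N → ℝ) :
    polyFun (p + q) x = polyFun p x + polyFun q x := by simp [polyFun]

lemma polyFun_sub (p q : MvPolynomial (Fin N) 𝕜) (x : Fin N → ℝ) :
    polyFun (p - q) x = polyFun p x - polyFun q x := by simp [polyFun]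

lemma polyFun_smul (c : 𝕜) (p : MvPolynomial (Fin N) 𝕜) (x : Fin N → ℝ) :
    polyFun (c • p) x = c * polyFun p x := by simp [polyFun, MvPolynomial.smul_eval]

lemma integrableOn_mul_polyFun {f : (Fin N → ℝ) → 𝕜} {a b : Fin N → ℝ}
    (hf : IntegrableOn f (Set.Icc a b)) (q : MvPolynomial (Fin N) 𝕜) :
    IntegrableOn (fun x => f x * polyFun q x) (Set.Icc a b) :=
  hf.mul_continuousOn (continuous_polyFun q).continuousOn isCompact_Icc

lemma integrableOn_polyFun (a b : Fin N → ℝ) (q : MvPolynomial (Fin N) 𝕜) :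
    IntegrableOn (polyFun q) (Set.Icc a b) :=
  (continuous_polyFun q).continuousOn.integrableOn_compact isCompact_Icc

/-- The linear functional `q ↦ ∫_Q f q` on polynomials of degree at most `d`. -/
def momentFunctional (d : ℕ) (a b : Fin N → ℝ) (f : (Fin N → ℝ) → 𝕜)
    (hf : IntegrableOn f (Set.Icc a b)) :
    Module.Dual 𝕜 (MvPolynomial.restrictTotalDegree (Fin N) 𝕜 d) where
  toFun q := ∫ x in Set.Icc a b, f x * polyFun q.1 x
  map_add' p q := by
    simp only [Submodule.coe_add, polyFun_add, mul_add]
    exact integral_add (integrableOn_mul_polyFun hf _) (integrableOn_mul_polyFun hf _)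
  map_smul' c p := by
    simp only [Submodule.coe_smul, polyFun_smul, RingHom.id_apply, smul_eq_mul]
    rw [← integral_const_mul]
    congr 1; ext x; ring

lemma momentFunctional_eq_zero_iff (d : ℕ) (a b : Fin N → ℝ) (f : (Fin N → ℝ) → 𝕜)
    (hf : IntegrableOn f (Set.Icc a b)) :
    momentFunctional d a b f hf = 0 ↔ VanishingMoments d (Set.Icc a b) f := by
  have key : ∀ β : Fin N →₀ ℕ, ∀ x : Fin N → ℝ,
      polyFun (MvPolynomial.monomial β (1 : 𝕜)) x = ∏ i, (x i : 𝕜) ^ β i := by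
    intro β x
    simp [polyFun, MvPolynomial.eval_monomial, Finsupp.prod_fintype]
  constructor
  · intro h β hβ
    have hm : MvPolynomial.monomial (Finsupp.equivFunOnFinite.symm β) (1 : 𝕜) ∈
        MvPolynomial.restrictTotalDegree (Fin N) 𝕜 d := by
      rw [MvPolynomial.mem_restrictTotalDegree]
      refine (MvPolynomial.totalDegree_monomial_le _ _).trans ?_
      rw [Finsupp.sum_fintype _ _ (fun _ => rfl)]
      simpa using hβ
    have := LinearMap.congr_fun h ⟨_, hm⟩
    simpa [momentFunctional, key] using this
  · intro h
    ext q
    obtain ⟨q, hq⟩ := q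
    rw [MvPolynomial.mem_restrictTotalDegree] at hq
    change ∫ x in Set.Icc a b, f x * polyFun q x = 0
    have e : ∀ x, f x * polyFun q x
        = ∑ β ∈ q.support, q.coeff β * (f x * ∏ i, (x i : 𝕜) ^ β i) := by
      intro x
      rw [polyFun, MvPolynomial.eval_eq', Finset.mul_sum]
      exact Finset.sum_congr rfl fun β _ => by ring
    simp_rw [e]
    rw [integral_finsetSum]
    · refine Finset.sum_eq_zero fun β hβ => ?_
      rw [integral_const_mul, h β, mul_zero]
      have := (MvPolynomial.le_totalDegree hβ).trans hq
      rwa [Finsupp.sum_fintype _ _ (fun _ => rfl)] at this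
    · intro β _
      refine Integrable.const_mul ?_ _
      have := integrableOn_mul_polyFun hf (MvPolynomial.monomial β (1 : 𝕜))
      simp_rw [key] at this
      exact this

/-- A polynomial that is orthogonal on a nondegenerate box to all polynomials of degree at most
its own is zero. -/
lemma poly_eq_zero_of_orthogonal {d : ℕ} {a b : Fin N → ℝ} (hab : ∀ i, a i < b i)
    {p : MvPolynomial (Fin N) 𝕜} (hp : p.totalDegree ≤ d)
    (h : ∀ q : MvPolynomial (Fin N) 𝕜, q.totalDegree ≤ d →
      ∫ x in Set.Icc a b, polyFun p x * polyFun q x = 0) : p = 0 := by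
  have hconj : ∀ x, polyFun (MvPolynomial.map (starRingEnd 𝕜) p) x
      = starRingEnd 𝕜 (polyFun p x) := by
    intro x
    rw [polyFun, polyFun, MvPolynomial.eval_map, MvPolynomial.eval, MvPolynomial.coe_eval₂Hom,
      MvPolynomial.hom_eval₂]
    simp
  have h1 := h (MvPolynomial.map (starRingEnd 𝕜) p)
    ((Finset.sup_mono (MvPolynomial.support_map_subset _ _)).trans hp)
  simp_rw [hconj, RCLike.mul_conj] at h1
  have h2 : ∫ x in Set.Icc a b, ‖polyFun p x‖ ^ 2 = 0 := by
    have : ((∫ x in Set.Icc a b, ‖polyFun p x‖ ^ 2 : ℝ) : 𝕜) = 0 := by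
      rw [← integral_ofReal]
      simpa using h1
    exact_mod_cast this
  have hc : Continuous fun x => ‖polyFun p x‖ ^ 2 := (continuous_polyFun p).norm.pow 2
  have hi : IntegrableOn (fun x => ‖polyFun p x‖ ^ 2) (Set.Icc a b) :=
    hc.continuousOn.integrableOn_compact isCompact_Icc
  rw [integral_eq_zero_iff_of_nonneg (fun x => by positivity) hi] at h2
  have hs : Set.pi Set.univ (fun i => Set.Ioo (a i) (b i)) ⊆ Set.Icc a b := by
    intro x hx
    exact ⟨fun i => (hx i trivial).1.le, fun i => (hx i trivial).2.le⟩
  have ho : IsOpen (Set.pi Set.univ (fun i => Set.Ioo (a i) (b i))) :=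
    isOpen_set_pi Set.finite_univ fun i _ => isOpen_Ioo
  have h3 := Measure.eqOn_open_of_ae_eq (ae_restrict_of_ae_restrict_of_subset hs h2) ho
    hc.continuousOn continuousOn_const
  refine MvPolynomial.funext_set (fun i => (fun t : ℝ => (t : 𝕜)) '' Set.Ioo (a i) (b i))
    (fun i => (Set.Ioo_infinite (hab i)).image RCLike.ofReal_injective.injOn) fun y hy => ?_
  choose x hx hxy using fun i => hy i trivial
  have h4 := h3 (show x ∈ Set.pi Set.univ (fun i => Set.Ioo (a i) (b i)) from fun i _ => hx i)
  have h5 : polyFun p x = 0 := by simpa using h4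
  rw [map_zero, ← h5, polyFun]
  congr 2
  ext i
  exact (hxy i).symm

/-- Existence and uniqueness of `p_Q(g)`. -/
theorem existsUnique_isMomentPoly (d : ℕ) {a : Fin N → ℝ} {ℓ : ℝ} (hℓ : 0 < ℓ)
    {g : (Fin N → ℝ) → 𝕜} (hg : IntegrableOn g (cube a ℓ)) :
    ∃! p, IsMomentPoly d (cube a ℓ) g p := by
  unfold cube at hg ⊢
  set b : Fin N → ℝ := fun i => a i + ℓ with hb
  have hab : ∀ i, a i < b i := fun i => by simp [hb, hℓ]
  let V := MvPolynomial.restrictTotalDegree (Fin N) 𝕜 d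
  let T : V →ₗ[𝕜] Module.Dual 𝕜 V :=
    { toFun := fun p => momentFunctional d a b (polyFun p.1) (integrableOn_polyFun a b _)
      map_add' := fun p q => by
        ext r
        simp only [momentFunctional, LinearMap.coe_mk, AddHom.coe_mk, Submodule.coe_add,
          polyFun_add, add_mul, LinearMap.add_apply]
        exact integral_add (integrableOn_mul_polyFun (integrableOn_polyFun a b _) _)
          (integrableOn_mul_polyFun (integrableOn_polyFun a b _) _)
      map_smul' := fun c p => by
        ext r
        simp only [momentFunctional, LinearMap.coe_mk, AddHom.coe_mk, Submodule.coe_smul,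
          polyFun_smul, mul_assoc, LinearMap.smul_apply, RingHom.id_apply, smul_eq_mul]
        exact integral_const_mul _ _ }
  have hinj : Function.Injective T := by
    rw [injective_iff_map_eq_zero]
    intro p hp
    refine Subtype.ext (poly_eq_zero_of_orthogonal (d := d) hab
      ((MvPolynomial.mem_restrictTotalDegree _ _ _).1 p.2) fun q hq => ?_)
    exact LinearMap.congr_fun hp ⟨q, (MvPolynomial.mem_restrictTotalDegree _ _ _).2 hq⟩
  have hsurj : Function.Surjective T :=
    (LinearMap.injective_iff_surjective_of_finrank_eq_finrank Subspace.dual_finrank_eq.symm).1 hinj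
  have hT : ∀ p : V, T p = momentFunctional d a b g hg ↔ IsMomentPoly d (Set.Icc a b) g p.1 := by
    intro p
    have hi : IntegrableOn (fun x => g x - polyFun p.1 x) (Set.Icc a b) :=
      hg.sub (integrableOn_polyFun a b _)
    have hdeg := (MvPolynomial.mem_restrictTotalDegree (Fin N) d p.1).1 p.2
    have : momentFunctional d a b _ hi = momentFunctional d a b g hg - T p := by
      ext r
      simp only [momentFunctional, LinearMap.coe_mk, AddHom.coe_mk, sub_mul,
        LinearMap.sub_apply, T]
      exact integral_sub (integrableOn_mul_polyFun hg _)
        (integrableOn_mul_polyFun (integrableOn_polyFun a b _) _)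
    rw [IsMomentPoly, ← momentFunctional_eq_zero_iff d a b _ hi, this, sub_eq_zero, eq_comm]
    exact ⟨fun h => ⟨hdeg, h⟩, fun h => h.2⟩
  obtain ⟨p, hp⟩ := hsurj (momentFunctional d a b g hg)
  refine ⟨p.1, (hT p).1 hp, fun q hq => ?_⟩
  have h1 := (hT ⟨q, (MvPolynomial.mem_restrictTotalDegree _ _ _).2 hq.1⟩).2 hq
  exact congrArg Subtype.val (hinj (h1.trans hp.symm))

end HelperFacts

section Splines

variable (𝕜 : Type*) [RCLike 𝕜] (N d : ℕ)

lemma lp_integrable {𝕜 : Type*} [RCLike 𝕜] {N : ℕ}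
    (f : Lp 𝕜 2 (volume.restrict (unitCube N))) : IntegrableOn f (unitCube N) := by
  have : IsFiniteMeasure (volume.restrict (unitCube N)) :=
    isFiniteMeasure_restrict.2 (by unfold unitCube; exact isCompact_Icc.measure_lt_top.ne)
  exact (Lp.memLp f).integrable (by norm_num)

lemma subcube_subset {N : ℕ} (S : Fin N → Bool) : subcube S ⊆ unitCube N := by
  intro x hx
  constructor <;> intro i
  · have := hx.1 i
    simp only at this ⊢
    split_ifs at this <;> linarith
  · have := hx.2 i
    simp only at this ⊢
    split_ifs at this <;> linarith

/-- The subspace `A` of `L²(Q₀)`: the functions with vanishing moments up to order `d` which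
coincide with a polynomial of degree at most `d` on each of the `2^N` dyadic subcubes of `Q₀`. -/
def splineSpace : Submodule 𝕜 (Lp 𝕜 2 (volume.restrict (unitCube N))) where
  carrier := {f | VanishingMoments d (unitCube N) f ∧
    ∀ S : Fin N → Bool, ∃ p : MvPolynomial (Fin N) 𝕜, p.totalDegree ≤ d ∧
      ∀ᵐ x ∂(volume.restrict (subcube S)), f x = polyFun p x}
  zero_mem' := by
    have h0 := Lp.coeFn_zero 𝕜 2 (volume.restrict (unitCube N))
    refine ⟨fun β _ => ?_, fun S => ⟨0, by simp, ?_⟩⟩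
    · refine integral_eq_zero_of_ae ?_
      filter_upwards [h0] with x hx
      rw [hx]; simp
    · filter_upwards [ae_restrict_of_ae_restrict_of_subset (subcube_subset S) h0] with x hx
      rw [hx]; simp [polyFun]
  add_mem' := by
    rintro f g ⟨hf1, hf2⟩ ⟨hg1, hg2⟩
    have h0 := Lp.coeFn_add f g
    refine ⟨?_, fun S => ?_⟩
    · have hf := lp_integrable f
      have hg := lp_integrable g
      have hfg := lp_integrable (f + g)
      unfold unitCube at *
      rw [← momentFunctional_eq_zero_iff d _ _ _ hf] at hf1
      rw [← momentFunctional_eq_zero_iff d _ _ _ hg] at hg1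
      rw [← momentFunctional_eq_zero_iff d _ _ _ hfg]
      ext q
      have hf1 := LinearMap.congr_fun hf1 q
      have hg1 := LinearMap.congr_fun hg1 q
      simp only [momentFunctional, LinearMap.coe_mk, AddHom.coe_mk, LinearMap.zero_apply]
        at hf1 hg1 ⊢
      rw [← add_zero (0 : 𝕜)]
      nth_rewrite 1 [← hf1]
      rw [← hg1, ← integral_add (integrableOn_mul_polyFun hf _) (integrableOn_mul_polyFun hg _)]
      refine integral_congr_ae ?_
      filter_upwards [h0] with x hx
      rw [hx, Pi.add_apply, add_mul]
    · obtain ⟨p, hp, hpf⟩ := hf2 S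
      obtain ⟨q, hq, hqg⟩ := hg2 S
      refine ⟨p + q, (MvPolynomial.totalDegree_add p q).trans (max_le hp hq), ?_⟩
      filter_upwards [hpf, hqg, ae_restrict_of_ae_restrict_of_subset (subcube_subset S) h0]
        with x h1 h2 h3
      rw [h3, Pi.add_apply, h1, h2, polyFun_add]
  smul_mem' := by
    rintro c f ⟨hf1, hf2⟩
    have h0 := Lp.coeFn_smul c f
    refine ⟨fun β hβ => ?_, fun S => ?_⟩
    · rw [← mul_zero c, ← hf1 β hβ, ← integral_const_mul]
      refine integral_congr_ae ?_
      filter_upwards [h0] with x hx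
      rw [hx, Pi.smul_apply, smul_eq_mul, mul_assoc]
    · obtain ⟨p, hp, hpf⟩ := hf2 S
      refine ⟨c • p, (MvPolynomial.totalDegree_smul_le c p).trans hp, ?_⟩
      filter_upwards [hpf, ae_restrict_of_ae_restrict_of_subset (subcube_subset S) h0]
        with x h1 h3
      rw [h3, Pi.smul_apply, h1, polyFun_smul, smul_eq_mul]

/-- The space `A` is finite dimensional, so it has finite orthonormal bases. -/
instance finiteDimensional_splineSpace : FiniteDimensional 𝕜 (splineSpace 𝕜 N d) := by
  have hint : ∀ (f : Lp 𝕜 2 (volume.restrict (unitCube N))) (S : Fin N → Bool),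
      IntegrableOn f (subcube S) := fun f S => (lp_integrable f).mono_set (subcube_subset S)
  let V := MvPolynomial.restrictTotalDegree (Fin N) 𝕜 d
  let T : splineSpace 𝕜 N d →ₗ[𝕜] ((Fin N → Bool) → Module.Dual 𝕜 V) :=
    { toFun := fun f S => momentFunctional d _ _ f.1 (hint f.1 S)
      map_add' := fun f g => by
        ext S q
        have h0 := ae_restrict_of_ae_restrict_of_subset (subcube_subset S)
          (Lp.coeFn_add f.1 g.1)
        simp only [momentFunctional, LinearMap.coe_mk, AddHom.coe_mk, Pi.add_apply,
          LinearMap.add_apply]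
        rw [← integral_add (integrableOn_mul_polyFun (hint f.1 S) _)
          (integrableOn_mul_polyFun (hint g.1 S) _)]
        refine integral_congr_ae ?_
        filter_upwards [h0] with x hx
        rw [Submodule.coe_add, hx, Pi.add_apply, add_mul]
      map_smul' := fun c f => by
        ext S q
        have h0 := ae_restrict_of_ae_restrict_of_subset (subcube_subset S)
          (Lp.coeFn_smul c f.1)
        simp only [momentFunctional, LinearMap.coe_mk, AddHom.coe_mk, Pi.smul_apply,
          LinearMap.smul_apply, RingHom.id_apply, smul_eq_mul]
        rw [← integral_const_mul]
        refine integral_congr_ae ?_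
        filter_upwards [h0] with x hx
        rw [Submodule.coe_smul, hx, Pi.smul_apply, smul_eq_mul, mul_assoc] }
  refine Module.Finite.of_injective T ?_
  rw [injective_iff_map_eq_zero]
  intro f hf
  have hS : ∀ S : Fin N → Bool, ∀ᵐ x ∂(volume.restrict (subcube S)), f.1 x = 0 := by
    intro S
    obtain ⟨p, hp, hpf⟩ := f.2.2 S
    have hp0 : p = 0 := by
      refine poly_eq_zero_of_orthogonal (d := d)
        (a := fun i => if S i then (0 : ℝ) else -1) (b := fun i => if S i then (1 : ℝ) else 0)
        (fun i => ?_) hp fun q hq => ?_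
      · split_ifs <;> norm_num
      · have := LinearMap.congr_fun (congrFun hf S)
          ⟨q, (MvPolynomial.mem_restrictTotalDegree _ _ _).2 hq⟩
        refine Eq.trans (integral_congr_ae ?_) this
        filter_upwards [hpf] with x hx
        rw [hx]
    filter_upwards [hpf] with x hx
    rw [hx, hp0]; simp [polyFun]
  have hcover : unitCube N ⊆ ⋃ S : Fin N → Bool, subcube S := by
    intro x hx
    refine Set.mem_iUnion.2 ⟨fun i => decide (0 ≤ x i), fun i => ?_, fun i => ?_⟩
    · by_cases h : 0 ≤ x i
      · simp [h]
      · simpa [h] using hx.1 i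
    · by_cases h : 0 ≤ x i
      · simpa [h] using hx.2 i
      · simpa [h] using (not_le.1 h).le
  refine Subtype.ext (Lp.ext ?_)
  have h1 : ∀ᵐ x ∂(volume.restrict (unitCube N)), f.1 x = 0 :=
    ae_restrict_of_ae_restrict_of_subset hcover ((ae_restrict_iUnion_iff _ _).2 hS)
  filter_upwards [h1, Lp.coeFn_zero 𝕜 2 (volume.restrict (unitCube N))] with x hx h0
  rw [hx]
  exact h0.symm

variable {𝕜 N d}

/-- The dilated and translated spline `x ↦ 2^{n(N+α)} p(2^n x + k)`, where `p ∈ L²(Q₀)` is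
extended by zero outside `Q₀`. -/
def dilatedSpline (α : ℝ) (p : Lp 𝕜 2 (volume.restrict (unitCube N))) (n : ℤ) (k : Fin N → ℤ)
    (x : Fin N → ℝ) : 𝕜 :=
  (((2 : ℝ) ^ ((n : ℝ) * (N + α)) : ℝ) : 𝕜) *
    (unitCube N).indicator p (fun i => 2 ^ n * x i + k i)

/-- The family `𝒮_α` of special splines obtained from the orthonormal basis `b` of `A`. -/
def specialSplines (α : ℝ) {M : ℕ} (b : OrthonormalBasis (Fin M) 𝕜 (splineSpace 𝕜 N ⌊α⌋₊)) :
    Set ((Fin N → ℝ) → 𝕜) :=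
  {s | ∃ (n : ℤ) (k : Fin N → ℤ) (L : Fin M), s = dilatedSpline α (b L).1 n k}

/-- `⟨g, s⟩ = ∫ g s̄`. -/
def pairing (g s : (Fin N → ℝ) → 𝕜) : 𝕜 := ∫ x, g x * starRingEnd 𝕜 (s x)

/-- `A_α(g) = sup_{s ∈ 𝒮_α} |⟨g, s⟩|`, as an extended nonnegative real. -/
def splineSup (α : ℝ) {M : ℕ} (b : OrthonormalBasis (Fin M) 𝕜 (splineSpace 𝕜 N ⌊α⌋₊))
    (g : (Fin N → ℝ) → 𝕜) : ℝ≥0∞ :=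
  ⨆ s ∈ specialSplines α b, ‖pairing g s‖ₑ

end Splines

end

end DyadicLipschitz

/-! The elements of the spline space `A` have norm-one basis vectors orthogonal on $Q_0$ to
$\mathcal P_{[\alpha]}$. Hence a spline coefficient of $g$ does not change when a polynomial is
subtracted from $g$, and Cauchy–Schwarz bounds it by the oscillation of $g$ over the dilated copy of
$Q_0$. Together with the fact that dyadic cubes are cubes, this gives the lower estimate.

For the upper estimate, a cube of side $\ell$ lies in a union of $2^N$ adjacent dyadic cubes of side
$r$ with $\ell\le r\le 2\ell$, and an affine map carries this union to $Q_0$. There the transported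
function $G$ is close to a piecewise polynomial $U$, by the dyadic norm. Let $q$ be the moment
polynomial of $U$ on $Q_0$. Then $U-q$ belongs to `A`, so its norm is controlled by its coefficients
$\langle U,p^L\rangle=\langle G,p^L\rangle-\langle G-U,p^L\rangle$, the first term by $A_\alpha(g)$
and the second by the dyadic norm. Thus $G=(G-U)+(U-q)+q$ is close to the single polynomial $q$
(`exists_polyFun_approx`). Moment polynomials are best $L^2$ approximations
(`IsMomentPoly.eLpNorm_sub_le`), so this bounds the oscillation over the original cube.

All estimates hold in $[0,\infty]$, so the equivalence of memberships follows from the inequalities.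
-/

namespace DyadicLipschitz

/-! ### Polynomials and $L^2$ approximation by moment polynomials. -/

section PolynomialFacts

variable {𝕜 : Type*} [RCLike 𝕜] {N : ℕ}

lemma exists_polyFun_conj (p : MvPolynomial (Fin N) 𝕜) :
    ∃ q : MvPolynomial (Fin N) 𝕜, q.totalDegree ≤ p.totalDegree ∧
      ∀ x, polyFun q x = starRingEnd 𝕜 (polyFun p x) := by
  refine ⟨MvPolynomial.map (starRingEnd 𝕜) p,
    Finset.sup_mono (MvPolynomial.support_map_subset _ _), fun x => ?_⟩
  rw [polyFun, polyFun, MvPolynomial.eval_map, MvPolynomial.eval, MvPolynomial.coe_eval₂Hom,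
    MvPolynomial.hom_eval₂]
  simp

lemma exists_polyFun_affine (s : ℝ) (t : Fin N → ℝ) (p : MvPolynomial (Fin N) 𝕜) :
    ∃ q : MvPolynomial (Fin N) 𝕜, q.totalDegree ≤ p.totalDegree ∧
      ∀ x, polyFun q x = polyFun p (fun i => s * x i + t i) := by
  let l : Fin N → MvPolynomial (Fin N) 𝕜 := fun i =>
    MvPolynomial.C (s : 𝕜) * MvPolynomial.X i + MvPolynomial.C (t i : 𝕜)
  have hl : ∀ i, (l i).totalDegree ≤ 1 := fun i => by
    refine (MvPolynomial.totalDegree_add _ _).trans (max_le ?_ (by simp))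
    refine (MvPolynomial.totalDegree_mul _ _).trans ?_
    simp
  refine ⟨∑ β ∈ p.support, MvPolynomial.C (p.coeff β) * ∏ i, l i ^ β i, ?_, fun x => ?_⟩
  · refine MvPolynomial.totalDegree_finsetSum_le fun β hβ => ?_
    refine (MvPolynomial.totalDegree_mul _ _).trans ?_
    rw [MvPolynomial.totalDegree_C, zero_add]
    refine (MvPolynomial.totalDegree_finsetProd _ _).trans ?_
    have h := MvPolynomial.le_totalDegree hβ
    rw [Finsupp.sum_fintype _ _ (fun _ => rfl)] at h
    refine (Finset.sum_le_sum fun i _ => ?_).trans h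
    refine (MvPolynomial.totalDegree_pow _ _).trans ?_
    exact (Nat.mul_le_mul_left _ (hl i)).trans (mul_one _).le
  · rw [polyFun, polyFun, MvPolynomial.eval_eq' _ p]
    simp [l]

lemma memLp_polyFun (a b : Fin N → ℝ) (p : MvPolynomial (Fin N) 𝕜) :
    MemLp (polyFun p) 2 (volume.restrict (Set.Icc a b)) := by
  have : IsFiniteMeasure (volume.restrict (Set.Icc a b)) :=
    isFiniteMeasure_restrict.2 isCompact_Icc.measure_lt_top.ne
  obtain ⟨C, hC⟩ := isCompact_Icc.exists_bound_of_continuousOn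
    (continuous_polyFun p).continuousOn (s := Set.Icc a b)
  refine MemLp.of_bound (continuous_polyFun p).aestronglyMeasurable C ?_
  exact (ae_restrict_iff' measurableSet_Icc).2 (Filter.Eventually.of_forall hC)

lemma integrableOn_Icc_of_memLp {a b : Fin N → ℝ} {f : (Fin N → ℝ) → 𝕜}
    (hf : MemLp f 2 (volume.restrict (Set.Icc a b))) : IntegrableOn f (Set.Icc a b) := by
  have : IsFiniteMeasure (volume.restrict (Set.Icc a b)) :=
    isFiniteMeasure_restrict.2 isCompact_Icc.measure_lt_top.ne
  exact hf.integrable (by norm_num)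

/-- Moments are taken without conjugation, the $L^2$ inner product with it. The polynomials of
degree at most $d$ are closed under conjugation, so vanishing moments still mean orthogonality. -/
lemma VanishingMoments.integral_polyFun_mul_conj {d : ℕ} {a b : Fin N → ℝ}
    {f : (Fin N → ℝ) → 𝕜} (hf : IntegrableOn f (Set.Icc a b))
    (h : VanishingMoments d (Set.Icc a b) f) {q : MvPolynomial (Fin N) 𝕜}
    (hq : q.totalDegree ≤ d) :
    ∫ x in Set.Icc a b, polyFun q x * starRingEnd 𝕜 (f x) = 0 := by
  obtain ⟨r, hr, hrq⟩ := exists_polyFun_conj q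
  rw [← momentFunctional_eq_zero_iff d a b f hf] at h
  have h1 := LinearMap.congr_fun h
    ⟨r, (MvPolynomial.mem_restrictTotalDegree _ _ _).2 (hr.trans hq)⟩
  have h2 : ∫ x in Set.Icc a b, f x * polyFun r x = 0 := h1
  rw [← map_zero (starRingEnd 𝕜), ← h2, ← integral_conj]
  congr 1
  ext x
  rw [map_mul, hrq, RCLike.conj_conj, mul_comm]

/-- Among the polynomials of degree at most `d`, the moment polynomial is the best approximation
in `L²`. -/
lemma IsMomentPoly.eLpNorm_sub_le {d : ℕ} {a b : Fin N → ℝ} {g : (Fin N → ℝ) → 𝕜}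
    (hg : MemLp g 2 (volume.restrict (Set.Icc a b))) {p q : MvPolynomial (Fin N) 𝕜}
    (hp : IsMomentPoly d (Set.Icc a b) g p) (hq : q.totalDegree ≤ d) :
    eLpNorm (fun x => g x - polyFun p x) 2 (volume.restrict (Set.Icc a b)) ≤
      eLpNorm (fun x => g x - polyFun q x) 2 (volume.restrict (Set.Icc a b)) := by
  have hF : MemLp (fun x => g x - polyFun p x) 2 (volume.restrict (Set.Icc a b)) :=
    hg.sub (memLp_polyFun a b p)
  have hP := memLp_polyFun a b (p - q)
  -- Pythagoras for $g-q=(g-p)+(p-q)$, where $g-p$ is orthogonal to the polynomial $p-q$.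
  have h0 : inner 𝕜 (hF.toLp _) (hP.toLp _) = 0 := by
    rw [L2.inner_def, ← hp.2.integral_polyFun_mul_conj (integrableOn_Icc_of_memLp hF)
      ((MvPolynomial.totalDegree_sub p q).trans (max_le hp.1 hq))]
    refine integral_congr_ae ?_
    filter_upwards [hF.coeFn_toLp, hP.coeFn_toLp] with x h1 h2
    rw [h1, h2, RCLike.inner_apply]
  have h1 := norm_add_sq_eq_norm_sq_add_norm_sq_of_inner_eq_zero _ _ h0
  have h2 : ‖hF.toLp _‖ ≤ ‖hF.toLp _ + hP.toLp _‖ := by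
    nlinarith [norm_nonneg (hF.toLp _), norm_nonneg (hP.toLp _),
      norm_nonneg (hF.toLp _ + hP.toLp _)]
  rw [← MemLp.toLp_add, ← enorm_le_iff_norm_le, Lp.enorm_toLp, Lp.enorm_toLp] at h2
  refine h2.trans (le_of_eq (congrArg (fun f => eLpNorm f 2 _) ?_))
  ext x
  rw [Pi.add_apply, polyFun_sub]
  ring

lemma isMomentPoly_momentPoly (d : ℕ) {a : Fin N → ℝ} {ℓ : ℝ} (hℓ : 0 < ℓ)
    {g : (Fin N → ℝ) → 𝕜} (hg : IntegrableOn g (cube a ℓ)) :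
    IsMomentPoly d (cube a ℓ) g (momentPoly d (cube a ℓ) g) := by
  have h := (existsUnique_isMomentPoly d hℓ hg).exists
  rw [momentPoly, dif_pos h]
  exact h.choose_spec

lemma unitCube_eq_cube : unitCube N = cube (fun _ => -1) 2 := by
  unfold unitCube cube
  norm_num

end PolynomialFacts

/-! ### Piecewise polynomials on the subcubes of $Q_0$. -/

section PiecewisePolynomials

variable {𝕜 : Type*} [RCLike 𝕜] {N : ℕ}

/-- The function on `Q₀` that agrees with `p S` on the interior of the subcube `S`. -/
noncomputable def piecewisePoly (p : (Fin N → Bool) → MvPolynomial (Fin N) 𝕜)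
    (x : Fin N → ℝ) : 𝕜 :=
  polyFun (p fun i => decide (0 ≤ x i)) x

lemma measurableSet_orthant (S : Fin N → Bool) :
    MeasurableSet {x : Fin N → ℝ | (fun i => decide (0 ≤ x i)) = S} := by
  have : {x : Fin N → ℝ | (fun i => decide (0 ≤ x i)) = S} =
      ⋂ i, {x : Fin N → ℝ | decide (0 ≤ x i) = S i} := by
    ext x
    simp [funext_iff]
  rw [this]
  refine MeasurableSet.iInter fun i => ?_
  have h : MeasurableSet {x : Fin N → ℝ | 0 ≤ x i} :=
    measurableSet_le measurable_const (measurable_pi_apply i)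
  cases hS : S i
  · simpa [Set.compl_def] using h.compl
  · simpa using h

lemma memLp_piecewisePoly (p : (Fin N → Bool) → MvPolynomial (Fin N) 𝕜) (a b : Fin N → ℝ) :
    MemLp (piecewisePoly p) 2 (volume.restrict (Set.Icc a b)) := by
  have h : piecewisePoly p = fun x => ∑ S, Set.indicator
      {x : Fin N → ℝ | (fun i => decide (0 ≤ x i)) = S} (polyFun (p S)) x := by
    ext x
    simp [piecewisePoly, Set.indicator_apply]
  rw [h]
  exact memLp_finsetSum _ fun S _ => (memLp_polyFun a b (p S)).indicator (measurableSet_orthant S)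

/-- Off the coordinate hyperplanes, which are null, the signs of the coordinates of a point of the
subcube determine $S$. -/
lemma piecewisePoly_ae_eq (p : (Fin N → Bool) → MvPolynomial (Fin N) 𝕜) (S : Fin N → Bool) :
    ∀ᵐ x ∂(volume.restrict (subcube S)), piecewisePoly p x = polyFun (p S) x := by
  have h0 : ∀ᵐ x : Fin N → ℝ, ∀ i, x i ≠ 0 := by
    rw [ae_all_iff]
    intro i
    rw [ae_iff]
    simp only [ne_eq, not_not]
    exact Measure.pi_hyperplane (fun _ : Fin N => (volume : Measure ℝ)) i 0
  filter_upwards [ae_restrict_of_ae h0, ae_restrict_mem (s := subcube S) measurableSet_Icc]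
    with x hx hxS
  have : (fun i => decide (0 ≤ x i)) = S := by
    ext i
    have h1 := hxS.1 i
    have h2 := hxS.2 i
    have h3 := hx i
    cases hS : S i <;> simp only [hS] at h1 h2 <;> simp at h1 h2 ⊢
    · exact lt_of_le_of_ne h2 h3
    · exact h1
  rw [piecewisePoly, this]

lemma unitCube_subset_iUnion_subcube : unitCube N ⊆ ⋃ S : Fin N → Bool, subcube S := by
  intro x hx
  refine Set.mem_iUnion.2 ⟨fun i => decide (0 ≤ x i), fun i => ?_, fun i => ?_⟩
  · by_cases h : 0 ≤ x i
    · simp [h]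
    · simpa [h] using hx.1 i
  · by_cases h : 0 ≤ x i
    · simpa [h] using hx.2 i
    · simpa [h] using (not_le.1 h).le

lemma eLpNorm_unitCube_le {f : (Fin N → ℝ) → 𝕜} {B : ℝ≥0∞}
    (h : ∀ S : Fin N → Bool, eLpNorm f 2 (volume.restrict (subcube S)) ≤ B) :
    eLpNorm f 2 (volume.restrict (unitCube N)) ≤ 2 ^ N * B := by
  have key : ∀ μ : Measure (Fin N → ℝ), eLpNorm f 2 μ ^ 2 = ∫⁻ x, ‖f x‖ₑ ^ 2 ∂μ := fun μ => by
    simpa using eLpNorm_nnreal_pow_eq_lintegral (p := 2) (f := f) (μ := μ) (by norm_num)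
  rw [← ENNReal.pow_le_pow_left_iff two_ne_zero, key]
  calc ∫⁻ x in unitCube N, ‖f x‖ₑ ^ 2
      ≤ ∫⁻ x in ⋃ S : Fin N → Bool, subcube S, ‖f x‖ₑ ^ 2 :=
        lintegral_mono_set unitCube_subset_iUnion_subcube
    _ ≤ ∑' S : Fin N → Bool, ∫⁻ x in subcube S, ‖f x‖ₑ ^ 2 := lintegral_iUnion_le _ _
    _ ≤ ∑' _ : Fin N → Bool, B ^ 2 := by
        refine ENNReal.tsum_le_tsum fun S => ?_
        rw [← key]
        gcongr
        exact h S
    _ = 2 ^ N * B ^ 2 := by simp [tsum_fintype]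
    -- Summing squares gives the factor $2^{N/2}$; it is enlarged to $2^N$ to keep integer powers.
    _ ≤ (2 ^ N * B) ^ 2 := by
        rw [mul_pow]
        have h2 : (1 : ℝ≥0∞) ≤ 2 ^ N := one_le_pow₀ (by norm_num)
        exact mul_le_mul' (le_self_pow₀ h2 two_ne_zero) le_rfl

end PiecewisePolynomials

/-! ### From approximation on the subcubes to approximation on $Q_0$. -/

section SplineApproximation

variable {𝕜 : Type*} [RCLike 𝕜] {N d M : ℕ}

lemma inner_spline_polyFun (f : splineSpace 𝕜 N d) {q : MvPolynomial (Fin N) 𝕜}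
    (hq : q.totalDegree ≤ d) (h : MemLp (polyFun q) 2 (volume.restrict (unitCube N))) :
    inner 𝕜 f.1 (h.toLp _) = 0 := by
  rw [L2.inner_def, ← f.2.1.integral_polyFun_mul_conj (lp_integrable f.1) hq]
  refine integral_congr_ae ?_
  filter_upwards [h.coeFn_toLp] with x h1
  rw [h1, RCLike.inner_apply]

lemma inner_toLp_eq_integral (f : Lp 𝕜 2 (volume.restrict (unitCube N))) {G : (Fin N → ℝ) → 𝕜}
    (h : MemLp G 2 (volume.restrict (unitCube N))) :
    inner 𝕜 f (h.toLp _) = ∫ x in unitCube N, G x * starRingEnd 𝕜 (f x) := by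
  rw [L2.inner_def]
  refine integral_congr_ae ?_
  filter_upwards [h.coeFn_toLp] with x h1
  rw [h1, RCLike.inner_apply]

/-- A basis spline is orthogonal to $q$, so $G$ may be replaced by $G-q$ before Cauchy–Schwarz. -/
lemma enorm_integral_mul_conj_basis_le (b : OrthonormalBasis (Fin M) 𝕜 (splineSpace 𝕜 N d))
    {G : (Fin N → ℝ) → 𝕜} (hG : MemLp G 2 (volume.restrict (unitCube N)))
    {q : MvPolynomial (Fin N) 𝕜} (hq : q.totalDegree ≤ d) (L : Fin M) :
    ‖∫ x in unitCube N, G x * starRingEnd 𝕜 ((b L).1 x)‖ₑ ≤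
      eLpNorm (fun x => G x - polyFun q x) 2 (volume.restrict (unitCube N)) := by
  have hQ : MemLp (polyFun q) 2 (volume.restrict (unitCube N)) := memLp_polyFun _ _ q
  have hF : MemLp (fun x => G x - polyFun q x) 2 (volume.restrict (unitCube N)) := hG.sub hQ
  have e : hF.toLp _ = hG.toLp _ - hQ.toLp _ := MemLp.toLp_sub hG hQ
  rw [← inner_toLp_eq_integral _ hG, ← Lp.enorm_toLp hF, enorm_le_iff_norm_le]
  have h1 : inner 𝕜 (b L).1 (hF.toLp _) = inner 𝕜 (b L).1 (hG.toLp _) := by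
    rw [e, inner_sub_right, inner_spline_polyFun (b L) hq hQ, sub_zero]
  rw [← h1]
  refine (norm_inner_le_norm _ _).trans ?_
  have h2 : ‖(b L).1‖ = 1 := b.orthonormal.1 L
  rw [h2, one_mul]

/-- A function that is close to polynomials on the subcubes of `Q₀` and has small spline
coefficients is close to one polynomial on `Q₀`. -/
theorem exists_polyFun_approx (b : OrthonormalBasis (Fin M) 𝕜 (splineSpace 𝕜 N d))
    {G : (Fin N → ℝ) → 𝕜} (hG : MemLp G 2 (volume.restrict (unitCube N)))
    {p : (Fin N → Bool) → MvPolynomial (Fin N) 𝕜} (hp : ∀ S, (p S).totalDegree ≤ d)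
    {B D : ℝ≥0∞}
    (hB : ∀ S, eLpNorm (fun x => G x - polyFun (p S) x) 2 (volume.restrict (subcube S)) ≤ B)
    (hD : ∀ L, ‖∫ x in unitCube N, G x * starRingEnd 𝕜 ((b L).1 x)‖ₑ ≤ D) :
    ∃ q : MvPolynomial (Fin N) 𝕜, q.totalDegree ≤ d ∧
      eLpNorm (fun x => G x - polyFun q x) 2 (volume.restrict (unitCube N)) ≤
        2 ^ N * B + M * (D + 2 ^ N * B) := by
  have hU : MemLp (piecewisePoly p) 2 (volume.restrict (unitCube N)) := memLp_piecewisePoly p _ _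
  have hq : IsMomentPoly d (unitCube N) (piecewisePoly p)
      (momentPoly d (unitCube N) (piecewisePoly p)) := by
    have hi : IntegrableOn (piecewisePoly p) (unitCube N) := integrableOn_Icc_of_memLp hU
    rw [unitCube_eq_cube] at hi ⊢
    exact isMomentPoly_momentPoly d two_pos hi
  set q := momentPoly d (unitCube N) (piecewisePoly p)
  have hQ : MemLp (polyFun q) 2 (volume.restrict (unitCube N)) := memLp_polyFun _ _ q
  have hGU : MemLp (fun x => G x - piecewisePoly p x) 2 (volume.restrict (unitCube N)) := hG.sub hU
  have hGQ : MemLp (fun x => G x - polyFun q x) 2 (volume.restrict (unitCube N)) := hG.sub hQ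
  have hUQ : MemLp (fun x => piecewisePoly p x - polyFun q x) 2
      (volume.restrict (unitCube N)) := hU.sub hQ
  have e1 : hGU.toLp _ = hG.toLp _ - hU.toLp _ := MemLp.toLp_sub hG hU
  have e2 : hGQ.toLp _ = hG.toLp _ - hQ.toLp _ := MemLp.toLp_sub hG hQ
  have e3 : hUQ.toLp _ = hU.toLp _ - hQ.toLp _ := MemLp.toLp_sub hU hQ
  have hN : ‖hGU.toLp _‖ₑ ≤ 2 ^ N * B := by
    rw [Lp.enorm_toLp]
    refine eLpNorm_unitCube_le fun S => (le_of_eq (eLpNorm_congr_ae ?_)).trans (hB S)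
    filter_upwards [piecewisePoly_ae_eq p S] with x hx
    rw [hx]
  -- Subtracting the moment polynomial kills the moments and keeps the function polynomial on each
  -- subcube, so the basis of `A` expands the difference.
  have hmem : hUQ.toLp _ ∈ splineSpace 𝕜 N d := by
    refine ⟨fun β hβ => ?_, fun S => ⟨p S - q,
      (MvPolynomial.totalDegree_sub _ _).trans (max_le (hp S) hq.1), ?_⟩⟩
    · rw [← hq.2 β hβ]
      refine integral_congr_ae ?_
      filter_upwards [hUQ.coeFn_toLp] with x hx
      rw [hx]
    · filter_upwards [ae_restrict_of_ae_restrict_of_subset (subcube_subset S) hUQ.coeFn_toLp,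
        piecewisePoly_ae_eq p S] with x h1 h2
      rw [h1, h2, polyFun_sub]
  -- The polynomial $q$ does not contribute: the coefficient is that of $G$ minus that of $G-U$.
  have hcoef : ∀ L, ‖inner 𝕜 (b L).1 (hUQ.toLp _)‖ₑ ≤ D + 2 ^ N * B := by
    intro L
    have : inner 𝕜 (b L).1 (hUQ.toLp _) =
        inner 𝕜 (b L).1 (hG.toLp _) - inner 𝕜 (b L).1 (hGU.toLp _) := by
      rw [e1, e3, inner_sub_right, inner_sub_right, inner_spline_polyFun (b L) hq.1 hQ]
      ring
    rw [this]
    refine enorm_sub_le.trans (add_le_add ?_ (le_trans ?_ hN))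
    · rw [inner_toLp_eq_integral]
      exact hD L
    · rw [enorm_le_iff_norm_le]
      refine (norm_inner_le_norm _ _).trans ?_
      have h2 : ‖(b L).1‖ = 1 := b.orthonormal.1 L
      rw [h2, one_mul]
  have hsum : ‖hUQ.toLp _‖ₑ ≤ M * (D + 2 ^ N * B) := by
    have h1 := congrArg Subtype.val (b.sum_repr' ⟨hUQ.toLp _, hmem⟩)
    simp only [Submodule.coe_inner, AddSubmonoidClass.coe_finsetSum, Submodule.coe_smul] at h1
    rw [← h1]
    refine (enorm_sum_le _ _).trans ((Finset.sum_le_sum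
      (g := fun _ => D + 2 ^ N * B) fun L _ => ?_).trans (le_of_eq (by simp [mul_add])))
    have h2 : ‖(b L).1‖ₑ = 1 := by
      rw [← ofReal_norm, show ‖(b L).1‖ = 1 from b.orthonormal.1 L, ENNReal.ofReal_one]
    rw [enorm_smul, h2, mul_one]
    exact hcoef L
  refine ⟨q, hq.1, ?_⟩
  rw [← Lp.enorm_toLp hGQ]
  have e4 : hGQ.toLp _ = hGU.toLp _ + hUQ.toLp _ := by
    rw [e1, e2, e3]
    abel
  rw [e4]
  exact (enorm_add_le _ _).trans (add_le_add hN hsum)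

end SplineApproximation

/-! ### Change of variables between $Q_0$ and its dilated copies. -/

section Rescaling

variable {𝕜 : Type*} [RCLike 𝕜] {N : ℕ}

/-- The affine map `y ↦ r (y - t)`. -/
def rescale (r : ℝ) (t y : Fin N → ℝ) : Fin N → ℝ := r • (y - t)

lemma rescale_apply (r : ℝ) (t y : Fin N → ℝ) (i : Fin N) :
    rescale r t y i = r * (y i - t i) := rfl

lemma measurableEmbedding_rescale {r : ℝ} (hr : 0 < r) (t : Fin N → ℝ) :
    MeasurableEmbedding (rescale r t) :=
  ((Homeomorph.subRight t).trans (Homeomorph.smulOfNeZero r hr.ne')).measurableEmbedding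

lemma map_rescale_volume {r : ℝ} (hr : 0 < r) (t : Fin N → ℝ) :
    Measure.map (rescale r t) volume = ENNReal.ofReal (r ^ N)⁻¹ • volume := by
  have h : rescale r t = (r • ·) ∘ (· - t) := rfl
  rw [h, ← Measure.map_map (measurable_const_smul r) (measurable_sub_const t),
    map_sub_right_eq_self, Measure.map_addHaar_smul _ hr.ne']
  simp [abs_of_pos hr]

lemma rescale_preimage_cube {r : ℝ} (hr : 0 < r) (t a : Fin N → ℝ) (ℓ : ℝ) :
    rescale r t ⁻¹' cube (rescale r t a) (r * ℓ) = cube a ℓ := by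
  ext y
  simp only [cube, Set.mem_preimage, Set.mem_Icc, Pi.le_def, rescale_apply, ← mul_add,
    mul_le_mul_iff_right₀ hr]
  refine and_congr (forall_congr' fun i => by simp) (forall_congr' fun i => ?_)
  constructor <;> intro h <;> linarith

lemma eLpNorm_comp_rescale {r : ℝ} (hr : 0 < r) (t a : Fin N → ℝ) (ℓ : ℝ)
    (f : (Fin N → ℝ) → 𝕜) :
    eLpNorm (fun y => f (rescale r t y)) 2 (volume.restrict (cube a ℓ)) =
      ENNReal.ofReal (r ^ (-(N / 2 : ℝ))) *
        eLpNorm f 2 (volume.restrict (cube (rescale r t a) (r * ℓ))) := by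
  have he := measurableEmbedding_rescale hr t
  have h1 := he.eLpNorm_map_measure (μ := volume.restrict (cube a ℓ)) (g := f) (p := 2)
  have h2 := he.restrict_map volume (cube (rescale r t a) (r * ℓ))
  rw [rescale_preimage_cube hr, map_rescale_volume hr, Measure.restrict_smul] at h2
  rw [← h2, eLpNorm_smul_measure_of_ne_top (by norm_num)] at h1
  have h3 : ENNReal.ofReal (r ^ N)⁻¹ ^ (1 / (2 : ℝ≥0∞)).toReal =
      ENNReal.ofReal (r ^ (-(N / 2 : ℝ))) := by
    rw [ENNReal.ofReal_rpow_of_pos (by positivity), ← Real.rpow_natCast, ← Real.rpow_neg hr.le,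
      ← Real.rpow_mul hr.le]
    congr 2
    simp
    ring
  rw [h3] at h1
  exact h1.symm

lemma integral_comp_rescale {r : ℝ} (hr : 0 < r) (t : Fin N → ℝ) (f : (Fin N → ℝ) → 𝕜) :
    ∫ x, f x = ((r ^ N : ℝ) : 𝕜) * ∫ y, f (rescale r t y) := by
  rw [← (measurableEmbedding_rescale hr t).integral_map, map_rescale_volume hr,
    integral_smul_measure, ENNReal.toReal_ofReal (by positivity), RCLike.real_smul_eq_coe_mul,
    ← mul_assoc, ← RCLike.ofReal_mul, mul_inv_cancel₀ (by positivity)]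
  simp

/-- The map `rescale` with ratio $r=2^{-n}$ and shift $k$ inverts $x\mapsto 2^nx+k$. Its Jacobian
$r^N$ cancels $2^{nN}$ and leaves $2^{n\alpha}=r^{-\alpha}$. -/
lemma enorm_pairing_dilatedSpline (α : ℝ) (p : Lp 𝕜 2 (volume.restrict (unitCube N))) (n : ℤ)
    (k : Fin N → ℤ) (g : (Fin N → ℝ) → 𝕜) :
    ‖pairing g (dilatedSpline α p n k)‖ₑ = ENNReal.ofReal (((2 : ℝ) ^ (-n)) ^ (-α)) *
      ‖∫ y in unitCube N,
        g (rescale (2 ^ (-n)) (fun i => (k i : ℝ)) y) * starRingEnd 𝕜 (p y)‖ₑ := by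
  have hr : (0 : ℝ) < 2 ^ (-n) := by positivity
  have hφ : ∀ y : Fin N → ℝ,
      (fun i => 2 ^ n * rescale (2 ^ (-n)) (fun i => (k i : ℝ)) y i + k i) = y := by
    intro y
    ext i
    rw [rescale_apply, ← mul_assoc, ← zpow_add₀ two_ne_zero]
    simp
  rw [pairing, integral_comp_rescale hr (fun i => (k i : ℝ))]
  simp only [dilatedSpline, hφ, map_mul, RCLike.conj_ofReal]
  have h1 : ∀ y, g (rescale (2 ^ (-n)) (fun i => (k i : ℝ)) y) *
      ((((2 : ℝ) ^ ((n : ℝ) * (N + α)) : ℝ) : 𝕜) *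
        starRingEnd 𝕜 ((unitCube N).indicator p y)) =
      (((2 : ℝ) ^ ((n : ℝ) * (N + α)) : ℝ) : 𝕜) * (unitCube N).indicator (fun y =>
        g (rescale (2 ^ (-n)) (fun i => (k i : ℝ)) y) * starRingEnd 𝕜 (p y)) y := by
    intro y
    by_cases hy : y ∈ unitCube N
    · simp only [Set.indicator_of_mem hy]; ring
    · simp only [Set.indicator_of_notMem hy]; simp
  simp only [h1]
  rw [integral_const_mul, integral_indicator (by exact measurableSet_Icc), ← mul_assoc,
    ← RCLike.ofReal_mul, enorm_mul]
  congr 1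
  rw [← ofReal_norm, RCLike.norm_ofReal, abs_of_pos (by positivity)]
  congr 1
  rw [← Real.rpow_intCast, ← Real.rpow_natCast, ← Real.rpow_mul zero_le_two,
    ← Real.rpow_mul zero_le_two, ← Real.rpow_add two_pos]
  congr 1
  push_cast
  ring

end Rescaling

/-! ### Oscillations over cubes and the Lipschitz norm. -/

section Oscillation

variable {𝕜 : Type*} [RCLike 𝕜] {N : ℕ}

lemma LocallySquareIntegrable.memLp_cube {g : (Fin N → ℝ) → 𝕜} (hg : LocallySquareIntegrable g)
    (a : Fin N → ℝ) (ℓ : ℝ) : MemLp g 2 (volume.restrict (cube a ℓ)) :=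
  hg _ isCompact_Icc

lemma volume_cube (a : Fin N → ℝ) (ℓ : ℝ) : volume (cube a ℓ) = ENNReal.ofReal ℓ ^ N := by
  simp [cube, Real.volume_Icc_pi]

/-- Since $|Q|=\ell^N$ with $N\ne 0$, both normalizations merge into one power of the side length,
which is easy to follow under rescaling. -/
lemma oscillation_cube (hN : 1 ≤ N) (α : ℝ) (g : (Fin N → ℝ) → 𝕜) (a : Fin N → ℝ) {ℓ : ℝ}
    (hℓ : 0 < ℓ) :
    oscillation α g (cube a ℓ) = ENNReal.ofReal (ℓ ^ (-(α + N / 2))) *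
      eLpNorm (fun y => g y - polyFun (momentPoly ⌊α⌋₊ (cube a ℓ) g) y) 2
        (volume.restrict (cube a ℓ)) := by
  have hN0 : (N : ℝ) ≠ 0 := by positivity
  have h0 : ENNReal.ofReal ℓ ≠ 0 := by simpa using hℓ
  have ht : ENNReal.ofReal ℓ ≠ ∞ := ENNReal.ofReal_ne_top
  rw [oscillation, volume_cube, eLpNorm_eq_lintegral_rpow_enorm_toReal two_ne_zero
    ENNReal.ofNat_ne_top, ENNReal.mul_rpow_of_nonneg _ _ (by norm_num), ← mul_assoc]
  congr 1
  · rw [← ENNReal.ofReal_rpow_of_pos hℓ, ← ENNReal.rpow_natCast, ← ENNReal.rpow_mul, one_div,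
      one_div, ← ENNReal.rpow_neg, ← ENNReal.rpow_neg, ← ENNReal.rpow_mul,
      ← ENNReal.rpow_add _ _ h0 ht]
    congr 1
    field_simp
    ring
  · simp

/-- The oscillation is controlled by the distance to any polynomial of degree at most `[α]`. -/
lemma oscillation_cube_le (hN : 1 ≤ N) (α : ℝ) {g : (Fin N → ℝ) → 𝕜}
    (hg : LocallySquareIntegrable g) (a : Fin N → ℝ) {ℓ : ℝ} (hℓ : 0 < ℓ)
    {q : MvPolynomial (Fin N) 𝕜} (hq : q.totalDegree ≤ ⌊α⌋₊) :
    oscillation α g (cube a ℓ) ≤ ENNReal.ofReal (ℓ ^ (-(α + N / 2))) *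
      eLpNorm (fun y => g y - polyFun q y) 2 (volume.restrict (cube a ℓ)) := by
  rw [oscillation_cube hN α g a hℓ]
  gcongr
  have h := hg.memLp_cube a ℓ
  exact (isMomentPoly_momentPoly _ hℓ (integrableOn_Icc_of_memLp h)).eLpNorm_sub_le h hq

/-- A set of positive measure contains a point where the maximal function is at most its essential
supremum, so the essential supremum misses no cube. -/
lemma oscillation_le_lipNorm {α : ℝ} {J : Set (Set (Fin N → ℝ))} (g : (Fin N → ℝ) → 𝕜)
    {Q : Set (Fin N → ℝ)} (hQ : Q ∈ J) (h0 : volume Q ≠ 0) :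
    oscillation α g Q ≤ lipNorm α J g := by
  obtain ⟨x, hx, h⟩ := ((frequently_ae_mem_iff.2 h0).and_eventually
    (ENNReal.ae_le_essSup (μ := volume) (sharpMaximal α J g))).exists
  refine le_trans ?_ h
  exact le_iSup₂_of_le Q hQ (le_iSup (fun _ : x ∈ Q => oscillation α g Q) hx)

lemma lipNorm_le {α : ℝ} {J : Set (Set (Fin N → ℝ))} {g : (Fin N → ℝ) → 𝕜} {B : ℝ≥0∞}
    (h : ∀ Q ∈ J, oscillation α g Q ≤ B) : lipNorm α J g ≤ B :=
  essSup_le_of_ae_le _ (Filter.Eventually.of_forall fun _ =>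
    iSup₂_le fun Q hQ => iSup_le fun _ => h Q hQ)

lemma le_ofReal_rpow_mul {ℓ : ℝ} (hℓ : 0 < ℓ) {s : ℝ} {x y : ℝ≥0∞}
    (h : ENNReal.ofReal (ℓ ^ (-s)) * x ≤ y) : x ≤ ENNReal.ofReal (ℓ ^ s) * y := by
  calc x = ENNReal.ofReal (ℓ ^ s) * (ENNReal.ofReal (ℓ ^ (-s)) * x) := by
        rw [← mul_assoc, ← ENNReal.ofReal_mul (by positivity), ← Real.rpow_add hℓ]
        simp
    _ ≤ _ := by gcongr

lemma eLpNorm_sub_momentPoly_le (hN : 1 ≤ N) (α : ℝ) {J : Set (Set (Fin N → ℝ))}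
    (g : (Fin N → ℝ) → 𝕜) {a : Fin N → ℝ} {ℓ : ℝ} (hℓ : 0 < ℓ) (hJ : cube a ℓ ∈ J) :
    eLpNorm (fun y => g y - polyFun (momentPoly ⌊α⌋₊ (cube a ℓ) g) y) 2
      (volume.restrict (cube a ℓ)) ≤ ENNReal.ofReal (ℓ ^ (α + N / 2)) * lipNorm α J g := by
  have h0 : volume (cube a ℓ) ≠ 0 := by
    rw [volume_cube]
    simp [hℓ]
  have h := oscillation_le_lipNorm (α := α) g hJ h0
  rw [oscillation_cube hN α g a hℓ] at h
  exact le_ofReal_rpow_mul hℓ h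

lemma dyadicCubes_subset_allCubes : dyadicCubes N ⊆ allCubes N := by
  rintro Q ⟨n, k, rfl⟩
  refine ⟨fun i => ((k i : ℝ) - 1) * 2 ^ n, 2 ^ n, by positivity, ?_⟩
  unfold cube
  congr 1
  ext i
  ring

lemma lipNorm_mono {α : ℝ} {J K : Set (Set (Fin N → ℝ))} (h : J ⊆ K)
    (hK : ∀ Q ∈ K, volume Q ≠ 0) (g : (Fin N → ℝ) → 𝕜) : lipNorm α J g ≤ lipNorm α K g :=
  lipNorm_le fun Q hQ => oscillation_le_lipNorm g (h hQ) (hK Q (h hQ))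

end Oscillation

/-! ### Comparison of the dyadic and the full norm. -/

section Comparison

variable {𝕜 : Type*} [RCLike 𝕜] {N : ℕ}

lemma rescale_cube_mem_dyadicCubes (n : ℤ) (k : Fin N → ℤ) (S : Fin N → Bool) :
    cube (rescale (2 ^ (-n)) (fun i => (k i : ℝ)) fun i => if S i then 0 else -1)
      (2 ^ (-n) * 1) ∈ dyadicCubes N := by
  -- Dyadic cubes are indexed by their upper corner, hence 1 or 0 in place of 0 or −1.
  refine ⟨-n, fun i => (if S i then 1 else 0) - k i, ?_⟩
  unfold cube
  congr 1 <;> ext i <;> rw [rescale_apply] <;> cases hS : S i <;> simp [hS] <;> ring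

lemma subcube_eq_cube (S : Fin N → Bool) :
    subcube S = cube (fun i => if S i then 0 else -1) 1 := by
  unfold subcube cube
  congr 1
  ext i
  cases hS : S i <;> simp [hS]

lemma exists_polyFun_comp_rescale (r : ℝ) (t : Fin N → ℝ) (p : MvPolynomial (Fin N) 𝕜) :
    ∃ q : MvPolynomial (Fin N) 𝕜, q.totalDegree ≤ p.totalDegree ∧
      ∀ y, polyFun q y = polyFun p (rescale r t y) := by
  obtain ⟨q, hq, h⟩ := exists_polyFun_affine r (fun i => -(r * t i)) p
  refine ⟨q, hq, fun y => ?_⟩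
  rw [h]
  congr 1
  ext i
  rw [rescale_apply]
  ring

lemma exists_polyFun_eq_comp_rescale {r : ℝ} (hr : 0 < r) (t : Fin N → ℝ)
    (p : MvPolynomial (Fin N) 𝕜) :
    ∃ q : MvPolynomial (Fin N) 𝕜, q.totalDegree ≤ p.totalDegree ∧
      ∀ y, polyFun q (rescale r t y) = polyFun p y := by
  obtain ⟨q, hq, h⟩ := exists_polyFun_affine r⁻¹ t p
  refine ⟨q, hq, fun y => ?_⟩
  rw [h]
  congr 1
  ext i
  rw [rescale_apply]
  field_simp
  ring

lemma LocallySquareIntegrable.memLp_comp_rescale {g : (Fin N → ℝ) → 𝕜}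
    (hg : LocallySquareIntegrable g) {r : ℝ} (hr : 0 < r) (t a : Fin N → ℝ) (ℓ : ℝ) :
    MemLp (fun y => g (rescale r t y)) 2 (volume.restrict (cube a ℓ)) := by
  have he := measurableEmbedding_rescale hr t
  have h := he.restrict_map volume (cube (rescale r t a) (r * ℓ))
  rw [rescale_preimage_cube hr, map_rescale_volume hr, Measure.restrict_smul] at h
  have h1 := (hg.memLp_cube (rescale r t a) (r * ℓ)).smul_measure
    (c := ENNReal.ofReal (r ^ N)⁻¹) ENNReal.ofReal_ne_top
  rw [h] at h1
  exact he.memLp_map_measure_iff.1 h1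

/-- The constant $2^{\alpha+N/2}$ appears because the copy of $Q_0$ has side $2r$ while the spline
is normalized with $r$. -/
lemma enorm_pairing_le_lipNorm (hN : 1 ≤ N) (α : ℝ) {M : ℕ}
    (b : OrthonormalBasis (Fin M) 𝕜 (splineSpace 𝕜 N ⌊α⌋₊)) {g : (Fin N → ℝ) → 𝕜}
    (hg : LocallySquareIntegrable g) (n : ℤ) (k : Fin N → ℤ) (L : Fin M) :
    ‖pairing g (dilatedSpline α (b L).1 n k)‖ₑ ≤
      ENNReal.ofReal (2 ^ (α + N / 2)) * lipNorm α (allCubes N) g := by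
  set r : ℝ := 2 ^ (-n)
  have hr : 0 < r := by positivity
  set t : Fin N → ℝ := fun i => (k i : ℝ)
  set a := rescale r t fun _ => -1
  have hg' := hg.memLp_cube a (r * 2)
  have hp := isMomentPoly_momentPoly ⌊α⌋₊ (mul_pos hr two_pos) (integrableOn_Icc_of_memLp hg')
  obtain ⟨q, hq, hqp⟩ := exists_polyFun_comp_rescale r t (momentPoly ⌊α⌋₊ (cube a (r * 2)) g)
  have hG := hg.memLp_comp_rescale hr t (fun _ => -1) 2
  rw [← unitCube_eq_cube] at hG
  rw [enorm_pairing_dilatedSpline]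
  have h1 := enorm_integral_mul_conj_basis_le b hG (hq.trans hp.1) L
  have h2 := eLpNorm_comp_rescale hr t (fun _ => -1) 2
    (fun x => g x - polyFun (momentPoly ⌊α⌋₊ (cube a (r * 2)) g) x)
  simp only [hqp] at h1
  rw [← unitCube_eq_cube] at h2
  rw [h2] at h1
  have h3 := eLpNorm_sub_momentPoly_le hN α g (mul_pos hr two_pos)
    (show cube a (r * 2) ∈ allCubes N from ⟨a, r * 2, by positivity, rfl⟩)
  calc _ ≤ ENNReal.ofReal (r ^ (-α)) * (ENNReal.ofReal (r ^ (-(N / 2 : ℝ))) *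
        (ENNReal.ofReal ((r * 2) ^ (α + N / 2)) * lipNorm α (allCubes N) g)) := by
        gcongr
        exact h1.trans (by gcongr)
    _ = _ := by
        rw [← mul_assoc, ← mul_assoc, ← ENNReal.ofReal_mul (by positivity),
          ← ENNReal.ofReal_mul (by positivity), Real.mul_rpow hr.le zero_le_two, ← mul_assoc,
          ← Real.rpow_add hr, ← Real.rpow_add hr]
        ring_nf
        simp [mul_comm]

lemma splineSup_le_lipNorm (hN : 1 ≤ N) (α : ℝ) {M : ℕ}
    (b : OrthonormalBasis (Fin M) 𝕜 (splineSpace 𝕜 N ⌊α⌋₊)) {g : (Fin N → ℝ) → 𝕜}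
    (hg : LocallySquareIntegrable g) :
    splineSup α b g ≤ ENNReal.ofReal (2 ^ (α + N / 2)) * lipNorm α (allCubes N) g := by
  refine iSup₂_le fun s hs => ?_
  obtain ⟨n, k, L, rfl⟩ := hs
  exact enorm_pairing_le_lipNorm hN α b hg n k L

/-- The distance of `g` to the polynomials on a union of `2^N` neighbouring dyadic cubes of
equal size. -/
lemma exists_polyFun_approx_rescale (hN : 1 ≤ N) (α : ℝ) {M : ℕ}
    (b : OrthonormalBasis (Fin M) 𝕜 (splineSpace 𝕜 N ⌊α⌋₊)) {g : (Fin N → ℝ) → 𝕜}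
    (hg : LocallySquareIntegrable g) (n : ℤ) (k : Fin N → ℤ) :
    ∃ q : MvPolynomial (Fin N) 𝕜, q.totalDegree ≤ ⌊α⌋₊ ∧
      eLpNorm (fun x => g x - polyFun q x) 2 (volume.restrict
        (cube (rescale (2 ^ (-n)) (fun i => (k i : ℝ)) fun _ => -1) (2 ^ (-n) * 2))) ≤
      ENNReal.ofReal (((2 : ℝ) ^ (-n)) ^ (α + N / 2)) *
        ((2 ^ N * (1 + M)) * (lipNorm α (dyadicCubes N) g + splineSup α b g)) := by
  set Λ := lipNorm α (dyadicCubes N) g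
  set A := splineSup α b g
  set r : ℝ := 2 ^ (-n)
  have hr : 0 < r := by positivity
  set t : Fin N → ℝ := fun i => (k i : ℝ)
  have hG := hg.memLp_comp_rescale hr t (fun _ => -1) 2
  rw [← unitCube_eq_cube] at hG
  let D : (Fin N → Bool) → Set (Fin N → ℝ) := fun S =>
    cube (rescale r t fun i => if S i then 0 else -1) (r * 1)
  have hr1 : 0 < r * 1 := by simpa using hr
  choose p hp hpD using fun S => exists_polyFun_comp_rescale r t (momentPoly ⌊α⌋₊ (D S) g)
  have hdeg : ∀ S, (p S).totalDegree ≤ ⌊α⌋₊ := fun S => (hp S).trans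
    (isMomentPoly_momentPoly _ hr1 (integrableOn_Icc_of_memLp (hg.memLp_cube _ _))).1
  -- The factor $r^{-N/2}$ from the change of variables turns $r^{\alpha+N/2}$ into $r^\alpha$, the
  -- factor that also multiplies the spline coefficients.
  have hB : ∀ S, eLpNorm (fun y => g (rescale r t y) - polyFun (p S) y) 2
      (volume.restrict (subcube S)) ≤ ENNReal.ofReal (r ^ α) * Λ := by
    intro S
    simp only [hpD]
    have h2 := eLpNorm_comp_rescale hr t (fun i => if S i then 0 else -1) 1
      (fun x => g x - polyFun (momentPoly ⌊α⌋₊ (D S) g) x)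
    have h3 := eLpNorm_sub_momentPoly_le hN α g hr1 (rescale_cube_mem_dyadicCubes n k S)
    rw [subcube_eq_cube, h2]
    calc _ ≤ ENNReal.ofReal (r ^ (-(N / 2 : ℝ))) *
          (ENNReal.ofReal ((r * 1) ^ (α + N / 2)) * Λ) := by
          gcongr
      _ = _ := by
          rw [← mul_assoc, ← ENNReal.ofReal_mul (by positivity), mul_one, ← Real.rpow_add hr]
          ring_nf
  have hA : ∀ L, ‖∫ y in unitCube N, g (rescale r t y) * starRingEnd 𝕜 ((b L).1 y)‖ₑ ≤
      ENNReal.ofReal (r ^ α) * A := by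
    intro L
    have h1 : ‖pairing g (dilatedSpline α (b L).1 n k)‖ₑ ≤ A :=
      le_iSup₂_of_le (dilatedSpline α (b L).1 n k) ⟨n, k, L, rfl⟩ le_rfl
    rw [enorm_pairing_dilatedSpline] at h1
    exact le_ofReal_rpow_mul hr h1
  obtain ⟨w, hw, hGw⟩ := exists_polyFun_approx b hG hdeg hB hA
  obtain ⟨q, hq, hqw⟩ := exists_polyFun_eq_comp_rescale hr t w
  refine ⟨q, hq.trans hw, ?_⟩
  have h2 := eLpNorm_comp_rescale hr t (fun _ => -1) 2 (fun x => g x - polyFun q x)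
  simp only [hqw, ← unitCube_eq_cube] at h2
  rw [h2] at hGw
  have h3 : 2 ^ N * (ENNReal.ofReal (r ^ α) * Λ) +
      M * (ENNReal.ofReal (r ^ α) * A + 2 ^ N * (ENNReal.ofReal (r ^ α) * Λ)) ≤
      ENNReal.ofReal (r ^ α) * ((2 ^ N * (1 + M)) * (Λ + A)) := by
    -- The spline term is enlarged by $2^N$ so that both quantities carry the same constant.
    have h4 : (1 : ℝ≥0∞) ≤ 2 ^ N := one_le_pow₀ (by norm_num)
    calc _ = ENNReal.ofReal (r ^ α) * (2 ^ N * Λ + M * (1 * A + 2 ^ N * Λ)) := by ring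
      _ ≤ ENNReal.ofReal (r ^ α) * (2 ^ N * (Λ + A) + M * (2 ^ N * A + 2 ^ N * Λ)) := by
          gcongr
          exact le_self_add
      _ = _ := by ring
  refine (le_ofReal_rpow_mul hr (hGw.trans h3)).trans (le_of_eq ?_)
  rw [← mul_assoc, ← ENNReal.ofReal_mul (by positivity), ← Real.rpow_add hr, add_comm α]

lemma exists_cube_subset_rescale (a : Fin N → ℝ) {ℓ : ℝ} (hℓ : 0 < ℓ) :
    ∃ (n : ℤ) (k : Fin N → ℤ), (2 : ℝ) ^ (-n) ≤ 2 * ℓ ∧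
      cube a ℓ ⊆ cube (rescale (2 ^ (-n)) (fun i => (k i : ℝ)) fun _ => -1) (2 ^ (-n) * 2) := by
  -- Here $2^m<\ell\le 2^{m+1}=r$. The block starts at the last point of $r\mathbb Z^N$ below $a$,
  -- at distance less than $r$ in each coordinate; its side $2r$ then leaves room for $\ell\le r$.
  -- The shift is minus the centre of the block in units of $r$.
  obtain ⟨m, hm, hm'⟩ := exists_mem_Ioc_zpow hℓ one_lt_two
  refine ⟨-(m + 1), fun i => -(⌊a i / 2 ^ (m + 1)⌋ + 1), ?_, ?_⟩
  · rw [neg_neg, zpow_add_one₀ two_ne_zero]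
    linarith
  · rw [neg_neg]
    set r : ℝ := 2 ^ (m + 1)
    have hr : 0 < r := by positivity
    have h : ∀ i, r * ⌊a i / r⌋ ≤ a i ∧ a i < r * ⌊a i / r⌋ + r := fun i => by
      have h1 := (le_div_iff₀ hr).1 (Int.floor_le (a i / r))
      have h2 := (div_lt_iff₀ hr).1 (Int.lt_floor_add_one (a i / r))
      constructor <;> linarith
    refine Set.Icc_subset_Icc (fun i => ?_) (fun i => ?_)
    · rw [rescale_apply]
      push_cast
      linarith [h i]
    · simp only [rescale_apply]
      push_cast
      linarith [h i]

theorem lipNorm_allCubes_le (hN : 1 ≤ N) {α : ℝ} (hα : 0 ≤ α) {M : ℕ}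
    (b : OrthonormalBasis (Fin M) 𝕜 (splineSpace 𝕜 N ⌊α⌋₊)) {g : (Fin N → ℝ) → 𝕜}
    (hg : LocallySquareIntegrable g) :
    lipNorm α (allCubes N) g ≤ ENNReal.ofReal (2 ^ (α + N / 2)) * (2 ^ N * (1 + M)) *
      (lipNorm α (dyadicCubes N) g + splineSup α b g) := by
  refine lipNorm_le ?_
  rintro Q ⟨a, ℓ, hℓ, rfl⟩
  obtain ⟨n, k, hr, hsub⟩ := exists_cube_subset_rescale a hℓ
  obtain ⟨q, hq, h⟩ := exists_polyFun_approx_rescale hN α b hg n k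
  refine (oscillation_cube_le hN α hg a hℓ hq).trans ?_
  have h1 := (eLpNorm_mono_measure (fun y => g y - polyFun q y) (p := 2)
    (Measure.restrict_mono_set volume hsub)).trans h
  -- Passing from the block to the smaller cube costs only this factor, since $r\le 2\ell$.
  have h2 : ℓ ^ (-(α + N / 2)) * ((2 : ℝ) ^ (-n)) ^ (α + N / 2) ≤ 2 ^ (α + N / 2 : ℝ) := by
    have h3 : ((2 : ℝ) ^ (-n)) ^ (α + N / 2) ≤ (2 * ℓ) ^ (α + N / 2 : ℝ) :=
      Real.rpow_le_rpow (by positivity) hr (by positivity)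
    rw [Real.mul_rpow zero_le_two hℓ.le] at h3
    calc _ ≤ ℓ ^ (-(α + N / 2)) * (2 ^ (α + N / 2 : ℝ) * ℓ ^ (α + N / 2 : ℝ)) := by gcongr
      _ = 2 ^ (α + N / 2 : ℝ) := by
        rw [mul_left_comm, ← Real.rpow_add hℓ]
        simp
  calc _ ≤ ENNReal.ofReal (ℓ ^ (-(α + N / 2))) *
        (ENNReal.ofReal (((2 : ℝ) ^ (-n)) ^ (α + N / 2)) *
        ((2 ^ N * (1 + M)) * (lipNorm α (dyadicCubes N) g + splineSup α b g))) := by gcongr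
    _ ≤ _ := by
        rw [← mul_assoc, ← ENNReal.ofReal_mul (by positivity), mul_assoc (ENNReal.ofReal (2 ^ _))]
        gcongr

end Comparison

end DyadicLipschitz

theorem theoremA {𝕜 : Type*} [RCLike 𝕜] (N : ℕ) (hN : 1 ≤ N) (α : ℝ) (hα : 0 ≤ α) :
    ∃ c C : ℝ≥0, 0 < c ∧ 0 < C ∧
      ∀ (M : ℕ)
        (b : OrthonormalBasis (Fin M) 𝕜 (DyadicLipschitz.splineSpace 𝕜 N ⌊α⌋₊))
        (g : (Fin N → ℝ) → 𝕜), DyadicLipschitz.LocallySquareIntegrable g →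
        (DyadicLipschitz.MemLip α (DyadicLipschitz.allCubes N) g ↔
          DyadicLipschitz.MemLip α (DyadicLipschitz.dyadicCubes N) g ∧
            DyadicLipschitz.splineSup α b g < ∞) ∧
        (c : ℝ≥0∞) * (DyadicLipschitz.lipNorm α (DyadicLipschitz.dyadicCubes N) g +
            DyadicLipschitz.splineSup α b g) ≤
          DyadicLipschitz.lipNorm α (DyadicLipschitz.allCubes N) g ∧
        DyadicLipschitz.lipNorm α (DyadicLipschitz.allCubes N) g ≤
          (C : ℝ≥0∞) * (DyadicLipschitz.lipNorm α (DyadicLipschitz.dyadicCubes N) g +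
            DyadicLipschitz.splineSup α b g) := by
  set κ : ℝ≥0 := Real.toNNReal (2 ^ (α + N / 2))
  have hκ0 : 0 < κ := Real.toNNReal_pos.2 (by positivity)
  -- The constants must precede the basis, so they use the dimension of `A`, which is the number of
  -- elements of any basis.
  set m := Module.finrank 𝕜 (DyadicLipschitz.splineSpace 𝕜 N ⌊α⌋₊)
  refine ⟨(1 + κ)⁻¹, κ * (2 ^ N * (1 + m)), by positivity, by positivity, fun M b g hg => ?_⟩
  have hM : M = m := by
    have h := Module.finrank_eq_card_basis b.toBasis
    rw [Fintype.card_fin] at h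
    exact h.symm
  have hupper := DyadicLipschitz.lipNorm_allCubes_le hN hα b hg
  have hdyadic := DyadicLipschitz.lipNorm_mono (α := α)
    (DyadicLipschitz.dyadicCubes_subset_allCubes (N := N)) (by
      rintro Q ⟨a, ℓ, hℓ, rfl⟩
      rw [DyadicLipschitz.volume_cube]
      simp [hℓ]) g
  have hspline := DyadicLipschitz.splineSup_le_lipNorm hN α b hg
  change _ ≤ (κ : ℝ≥0∞) * _ at hspline
  have hC : ENNReal.ofReal (2 ^ (α + N / 2)) * (2 ^ N * (1 + M)) =
      ((κ * (2 ^ N * (1 + m)) : ℝ≥0) : ℝ≥0∞) := by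
    rw [hM]
    push_cast
    rfl
  rw [hC] at hupper
  refine ⟨⟨fun h => ⟨⟨hg, hdyadic.trans_lt h.2⟩, hspline.trans_lt
    (ENNReal.mul_lt_top ENNReal.coe_lt_top h.2)⟩, fun h => ⟨hg, hupper.trans_lt
    (ENNReal.mul_lt_top ENNReal.coe_lt_top (ENNReal.add_lt_top.2 ⟨h.1.2, h.2⟩))⟩⟩, ?_, hupper⟩
  -- The dyadic norm costs a factor 1 and the spline supremum a factor $\kappa$, whence
  -- $c=(1+\kappa)^{-1}$.
  have h0 : (1 + κ : ℝ≥0) ≠ 0 := by positivity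
  rw [ENNReal.coe_inv h0, mul_comm, ← div_eq_mul_inv]
  refine ENNReal.div_le_of_le_mul' ?_
  push_cast
  rw [add_mul, one_mul]
  exact add_le_add hdyadic hspline
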